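/- Let $\mathcal X$ be a non-empty finite set, $\mathcal Y$ a finite abelian group of cardinality $M$, $\mathcal Z$ a set, and $f:\mathcal X\times\mathcal Y\to\mathcal Z$ a function. Put $$\Gamma := \max_{x\neq x'\in\mathcal X,\; y'\in\mathcal Y}\bigl|\{y\in\mathcal Y : f(x,y)=f(x',y')\}\bigr|,$$ with $\Gamma := 0$ if $|\mathcal X| = 1$. Let $k\ge 1$ and $q\ge 0$ be integers. A $k$-parallel $q$-query quantum algorithm with output in $\mathcal X\times\mathcal X$ acts on $\mathbb C[\mathcal X]^{\otimes k}\otimes\mathbb C[\mathcal Y]^{\otimes k}\otimes\mathbb C^d$ for some finite $d$. It starts in a fixed unit vector and performs $q$ rounds, each consisting of one $k$-parallel query $$|x_1,\dots,x_k\rangle|y_1,\dots,y_k\rangle|w\rangle\mapsto|x_1,\dots,x_k\rangle|y_1+H(x_1),\dots,y_k+H(x_k)\rangle|w\rangle$$ to an oracle $H:\mathcal X\to\mathcal Y$, followed by a unitary that does not depend on $H$. It then measures in the computational basis, and its output $(x,x')$ is a function of the measurement result. For any such algorithm, the probability $p$, over a uniformly random $H:\mathcal X\to\mathcal Y$ and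 the measurement, that the output $(x,x')$ satisfies $x\ne x'$ and $f(x,H(x))=f(x',H(x'))$ is bounded by $$p\;\le\;\biggl(2(q+1)\,e\,k\sqrt{10\,\Gamma\,\frac{q+1}{M}}+\frac{2}{\sqrt M}\biggr)^2 .$$ Moreover, there is a universal constant $C>0$, independent of all of the data above, such that $p\le C\,k^2q^3\Gamma/M$ whenever $q\ge1$, and such that the right-hand side of the displayed bound is itself at most $C\,k^2q^3\Gamma/M$ whenever $q\ge 1$ and $\Gamma\ge 1$. -/

import Mathlib

namespace ParallelQROM

/-- Labels of the computational basis of `ℂ[X]^{⊗k} ⊗ ℂ[Y]^{⊗k} ⊗ ℂ^d`: the `k` input registers,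
the `k` output registers and a `d`-dimensional work register of the algorithm. -/
abbrev Label (X Y : Type*) (k d : ℕ) : Type _ :=
  (Fin k → X) × (Fin k → Y) × Fin d

/-- The Hilbert space `ℂ[X]^{⊗k} ⊗ ℂ[Y]^{⊗k} ⊗ ℂ^d` with its Euclidean inner product. -/
abbrev StateSpace (X Y : Type*) (k d : ℕ) : Type _ :=
  EuclideanSpace ℂ (Label X Y k d)

/-- The permutation `(x, y, w) ↦ (x, y + H(x), w)` of the basis labels, where
`H(x) = (H(x₁), …, H(x_k))`. -/
def queryPerm {X Y : Type*} [AddCommGroup Y] (k d : ℕ) (H : X → Y) :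
    Label X Y k d ≃ Label X Y k d where
  toFun b := (b.1, fun i => b.2.1 i + H (b.1 i), b.2.2)
  invFun b := (b.1, fun i => b.2.1 i - H (b.1 i), b.2.2)
  left_inv b := by simp
  right_inv b := by simp

/-- The `k`-parallel query to the oracle `H`: the unitary
`|x⟩|y⟩|w⟩ ↦ |x⟩|y + H(x)⟩|w⟩`. -/
noncomputable def query {X Y : Type*} [Fintype X] [Fintype Y] [AddCommGroup Y] (k d : ℕ)
    (H : X → Y) : StateSpace X Y k d ≃ₗᵢ[ℂ] StateSpace X Y k d :=
  LinearIsometryEquiv.piLpCongrLeft 2 ℂ ℂ (queryPerm k d H)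

/-- A `k`-parallel `q`-query quantum oracle algorithm with classical output in `Ω`. It starts in a
fixed unit vector, performs `q` rounds, each of which consists of one `k`-parallel query followed
by a fixed unitary, and finally measures all its registers in the computational basis; the output
is a function of the measurement result. The work register may have any finite dimension. -/
structure Algorithm (X Y Ω : Type*) [Fintype X] [Fintype Y] (k q : ℕ) where
  d : ℕ
  init : StateSpace X Y k d
  norm_init : ‖init‖ = 1
  U : Fin q → (StateSpace X Y k d ≃ₗᵢ[ℂ] StateSpace X Y k d)
  out : Label X Y k d → Ω

namespace Algorithm

variable {X Y Ω : Type*} [Fintype X] [Fintype Y] [AddCommGroup Y] {k q : ℕ}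

/-- The state of the algorithm after each number `0, …, q` of rounds with the oracle `H`. -/
noncomputable def state (A : Algorithm X Y Ω k q) (H : X → Y) :
    Fin (q + 1) → StateSpace X Y k A.d :=
  Fin.induction A.init (fun s ψ => A.U s (query k A.d H ψ))

open Classical in
/-- The probability that the algorithm, run with the oracle `H`, gives an output in `S`. -/
noncomputable def outputProb (A : Algorithm X Y Ω k q) (H : X → Y) (S : Set Ω) : ℝ :=
  ∑ b : Label X Y k A.d, if A.out b ∈ S then ‖A.state H (Fin.last q) b‖ ^ 2 else 0

open Classical in
/-- The probability that the output `ω` satisfies `win H ω`, for an oracle `H` that is uniformly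
random among all functions `X → Y`. -/
noncomputable def successProb (A : Algorithm X Y Ω k q) (win : (X → Y) → Ω → Prop) : ℝ :=
  (∑ H : X → Y, A.outputProb H {ω | win H ω}) / (Fintype.card (X → Y) : ℝ)

end Algorithm

/-- The pair `p = (x, x')` is a generalized collision of `H`: two distinct inputs with
`f(x, H(x)) = f(x', H(x'))`. -/
def IsGenCollision {X Y Z : Type*} (f : X × Y → Z) (H : X → Y) (p : X × X) : Prop :=
  p.1 ≠ p.2 ∧ f (p.1, H p.1) = f (p.2, H p.2)

open Classical in
/-- `Γ = max_{x ≠ x', y'} |{y | f(x, y) = f(x', y')}|`, and `0` if `X` has no two elements. -/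
noncomputable def Gam {X Y Z : Type*} [Fintype X] [Fintype Y] (f : X × Y → Z) : ℕ :=
  (Finset.univ.filter fun t : X × X × Y => t.1 ≠ t.2.1).sup fun t =>
    (Finset.univ.filter fun y : Y => f (t.1, y) = f (t.2.1, t.2.2)).card

/-- `(2 (q+1) e k √(10 Γ (q+1) / M) + 2 / √M)²` -/
noncomputable def collisionBound (k q Γ M : ℕ) : ℝ :=
  (2 * ((q : ℝ) + 1) * Real.exp 1 * (k : ℝ) * √(10 * (Γ : ℝ) * (((q : ℝ) + 1) / (M : ℝ)))
    + 2 / √(M : ℝ)) ^ 2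

end ParallelQROM

/-!
The proof is a compressed-oracle argument. A uniformly random `H` is purified: the joint state of
oracle and algorithm is `∑_H |H⟩ ⊗ ψ_H / √(M ^ |X|)`, and it lives in the space `Reg`, in which the
oracle has one register with basis `Option Y` for each `x : X`. On each register the reflection
`compress x` exchanges `|none⟩` with the uniform superposition `∑_y |some y⟩ / √M`. After this
change of basis, a basis vector `D : X → Option Y` is a *database*: `D x = none` means that the
algorithm knows nothing about `H x`. Initially the database is empty
(`mask_largeOff_compressOn_joint_const`), and a `k`-parallel query fills at most `k` registers
(`mask_largeOff_compressedQuery`).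

The central quantity is the leakage of an operator `A` into a set `S` of databases, a bound `c` on
the norm of (projection on `S`) ∘ `A` ∘ (projection on `Sᶜ`). It is subadditive under composition of
isometries (`Leak.mul`) and vanishes if `A` commutes with the projection. For one reflection
`compress x` it is at most `√(2 n / M)` when, the other registers being fixed, at most `n` values of
the register `x` lead into `S` (`leak_compress`): the reflection is `1 - w wᵀ` with `|w_y|² = 1 / M`
and `‖w‖² = 2`.

When the inputs are fixed to `x₁, …, x_k`, the query becomes a product of operators
`compress x * oracleAt x * compress x` over the distinct `x` among them
(`compressedQueryAt_insert`). A collision created by the query on a database with at most `n`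
entries involves a queried register. Either its partner is not queried, and the leakage into that
event is at most `2 √(2 n Γ / M)`; or both are queried, and it is at most `4 √(2 Γ / M)`. The
squares of these norms add up, over at most `k` events of the first kind and `k ^ 2` of the second,
to at most `(8 n k + 32 k ^ 2) Γ / M` (`norm_mask_collision_compressedQuery_le`). It is this sum of
squares that gives the factor `k` rather than `k ^ (3 / 2)` in the amplitude. As `n = k s` after `s`
rounds, the amplitude on databases with a collision is at most `q √(32 k ^ 2 q Γ / M)` after `q`
rounds (`norm_mask_collision_run_le`).

Finally, the output `(x, x')` is checked against `H` and not against the database. Undoing the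
change of basis on the registers `x` and `x'` leaks at most `2 √(2 Γ / M)`
(`norm_accept_compressOn_le`). Hence `p ≤ (q √(32 k ^ 2 q Γ / M) + √(8 Γ / M)) ^ 2`
(`successProb_le`), which is below both claimed bounds, also for `Γ = 0`.
-/

namespace ParallelQROM
open Finset

/-! ### The space of the oracle registers -/

section Registers

variable {X Y R : Type*} [Fintype X] [DecidableEq X] [Fintype Y] [NormedAddCommGroup R]

/-- The joint Hilbert space `(ℂ^(Option Y))^{⊗X} ⊗ R` of the oracle registers and a further system
`R`, written as the `ℓ²` families of vectors of `R` indexed by the basis labels `D : X → Option Y`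
of the oracle registers. -/
abbrev Reg (X Y R : Type*) [Fintype X] [DecidableEq X] [Fintype Y] [NormedAddCommGroup R] :
    Type _ :=
  PiLp 2 fun _ : X → Option Y => R

theorem Reg.norm_sq (Ψ : Reg X Y R) : ‖Ψ‖ ^ 2 = ∑ D, ‖Ψ D‖ ^ 2 :=
  PiLp.norm_sq_eq_of_L2 _ Ψ

variable [InnerProductSpace ℂ R]

/-- Each `D` arises `|A|` times as an update at `x`, since `(D, b) ↦ (update D x b, D x)` is an
involution. -/
theorem sum_sum_update {A : Type*} [Fintype A] (x : X) (g : (X → A) → ℝ) :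
    ∑ D : X → A, ∑ b : A, g (Function.update D x b) = Fintype.card A * ∑ D, g D := by
  classical
  have hinv : Function.Involutive
      (fun p : (X → A) × A => (Function.update p.1 x p.2, p.1 x)) := by
    rintro ⟨D, b⟩
    simp
  rw [← Fintype.sum_prod_type' (f := fun D b => g (Function.update D x b)),
    show ∑ p : (X → A) × A, g (Function.update p.1 x p.2) = ∑ p : (X → A) × A, g p.1 from
      Equiv.sum_comp hinv.toPerm (fun p : (X → A) × A => g p.1), Fintype.sum_prod_type]
  simp [mul_sum]

/-- A sum over all `D` can be compared on each register `x` separately. -/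
theorem sum_le_sum_of_fibres {A : Type*} [Fintype A] [Nonempty A] (x : X) {g g' : (X → A) → ℝ}
    (h : ∀ D, ∑ b, g (Function.update D x b) ≤ ∑ b, g' (Function.update D x b)) :
    ∑ D, g D ≤ ∑ D, g' D := by
  have h1 := sum_le_sum fun D (_ : D ∈ univ) => h D
  rw [sum_sum_update, sum_sum_update] at h1
  exact le_of_mul_le_mul_left h1 (by exact_mod_cast Fintype.card_pos)

/-! ### Block-diagonal operators -/

/-- The operator that acts on `R` by `V D` when the oracle registers are in the basis state `D`.
-/
def diag (V : (X → Option Y) → Module.End ℂ R) : Module.End ℂ (Reg X Y R) where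
  toFun Ψ := WithLp.toLp 2 fun D => V D (Ψ D)
  map_add' Ψ Φ := by ext D; simp
  map_smul' c Ψ := by ext D; simp

@[simp] theorem diag_apply (V : (X → Option Y) → Module.End ℂ R) (Ψ : Reg X Y R)
    (D : X → Option Y) : diag V Ψ D = V D (Ψ D) := rfl

theorem norm_diag {V : (X → Option Y) → Module.End ℂ R} (hV : ∀ D r, ‖V D r‖ = ‖r‖)
    (Ψ : Reg X Y R) : ‖diag V Ψ‖ = ‖Ψ‖ := by
  rw [← sq_eq_sq₀ (norm_nonneg _) (norm_nonneg _), Reg.norm_sq, Reg.norm_sq]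
  simp [hV]

open Classical in
/-- The projection onto the span of the basis states `D ∈ S` of the oracle registers. -/
noncomputable def mask (S : Set (X → Option Y)) : Module.End ℂ (Reg X Y R) :=
  diag fun D => if D ∈ S then 1 else 0

open Classical in
theorem mask_apply (S : Set (X → Option Y)) (Ψ : Reg X Y R) (D : X → Option Y) :
    mask S Ψ D = if D ∈ S then Ψ D else 0 := by
  by_cases h : D ∈ S <;> simp [mask, h]

theorem mask_apply_mem {S : Set (X → Option Y)} (Ψ : Reg X Y R) {D : X → Option Y} (h : D ∈ S) :
    mask S Ψ D = Ψ D := by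
  simp [mask_apply, h]

theorem mask_apply_notMem {S : Set (X → Option Y)} (Ψ : Reg X Y R) {D : X → Option Y}
    (h : D ∉ S) : mask S Ψ D = 0 := by
  simp [mask_apply, h]

theorem mask_add_mask_compl (S : Set (X → Option Y)) (Ψ : Reg X Y R) :
    mask S Ψ + mask Sᶜ Ψ = Ψ := by
  ext D
  by_cases h : D ∈ S <;> simp [mask_apply, h]

theorem mask_mask_compl (S : Set (X → Option Y)) (Ψ : Reg X Y R) : mask S (mask Sᶜ Ψ) = 0 := by
  ext D
  by_cases h : D ∈ S <;> simp [mask_apply, h]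

theorem norm_mask_sq_le_of_subset {S T : Set (X → Option Y)} (h : S ⊆ T) (Ψ : Reg X Y R) :
    ‖mask S Ψ‖ ^ 2 ≤ ‖mask T Ψ‖ ^ 2 := by
  rw [Reg.norm_sq, Reg.norm_sq]
  refine sum_le_sum fun D _ => ?_
  by_cases hD : D ∈ S
  · rw [mask_apply_mem _ hD, mask_apply_mem _ (h hD)]
  · rw [mask_apply_notMem _ hD, norm_zero, zero_pow two_ne_zero]
    exact sq_nonneg _

theorem norm_mask_le (S : Set (X → Option Y)) (Ψ : Reg X Y R) : ‖mask S Ψ‖ ≤ ‖Ψ‖ := by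
  have h := norm_mask_sq_le_of_subset (Set.subset_univ S) Ψ
  have h2 : mask Set.univ Ψ = Ψ := by ext D; simp [mask_apply]
  rw [h2] at h
  exact le_of_sq_le_sq h (norm_nonneg _)

theorem norm_mask_union_sq_le (S T : Set (X → Option Y)) (Ψ : Reg X Y R) :
    ‖mask (S ∪ T) Ψ‖ ^ 2 ≤ ‖mask S Ψ‖ ^ 2 + ‖mask T Ψ‖ ^ 2 := by
  rw [Reg.norm_sq, Reg.norm_sq, Reg.norm_sq, ← sum_add_distrib]
  refine sum_le_sum fun D _ => ?_
  by_cases hS : D ∈ S <;> by_cases hT : D ∈ T <;> simp [mask_apply, hS, hT]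

theorem norm_mask_biUnion_sq_le {ι : Type*} (J : Finset ι) (S : ι → Set (X → Option Y))
    (Ψ : Reg X Y R) : ‖mask (⋃ j ∈ J, S j) Ψ‖ ^ 2 ≤ ∑ j ∈ J, ‖mask (S j) Ψ‖ ^ 2 := by
  classical
  induction J using Finset.induction_on with
  | empty =>
    have : mask (∅ : Set (X → Option Y)) Ψ = 0 := by ext D; simp [mask_apply]
    simp [this]
  | insert j J hj ih =>
    rw [sum_insert hj, Finset.set_biUnion_insert]
    exact (norm_mask_union_sq_le _ _ _).trans (by gcongr)

theorem mask_eq_zero_mono {S T : Set (X → Option Y)} (h : S ⊆ T) {Ψ : Reg X Y R}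
    (hT : mask T Ψ = 0) : mask S Ψ = 0 := by
  have := norm_mask_sq_le_of_subset h Ψ
  rw [hT, norm_zero] at this
  exact norm_eq_zero.1 (by nlinarith [norm_nonneg (mask S Ψ)])

theorem mask_diag (S : Set (X → Option Y)) (V : (X → Option Y) → Module.End ℂ R)
    (Ψ : Reg X Y R) : mask S (diag V Ψ) = diag V (mask S Ψ) := by
  ext D
  by_cases h : D ∈ S <;> simp [mask_apply, h]

theorem mask_comm (S T : Set (X → Option Y)) (Ψ : Reg X Y R) :
    mask S (mask T Ψ) = mask T (mask S Ψ) :=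
  mask_diag S _ Ψ

/-! ### The change of basis on one register -/

/-- The axis `w` of the reflection `1 - w wᵀ` that exchanges `|none⟩` and `∑_y |some y⟩ / √M`. It
is normalised by `‖w‖² = 2`. -/
noncomputable def axis (Y : Type*) [Fintype Y] : Option Y → ℝ
  | none => 1
  | some _ => -(1 / √(Fintype.card Y : ℝ))

theorem axis_some_sq [Nonempty Y] (y : Y) : axis Y (some y) ^ 2 = 1 / (Fintype.card Y : ℝ) := by
  simp [axis]

theorem sum_axis_sq [Nonempty Y] : ∑ b, axis Y b ^ 2 = 2 := by
  rw [Fintype.sum_option]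
  simp only [axis_some_sq]
  simp [axis]
  norm_num

/-- The inner product `∑_b w_b v_b` of a vector `v` of `ℂ^(Option Y) ⊗ R` with the reflection
axis. -/
noncomputable def axisCoeff (v : Option Y → R) : R := ∑ b, (axis Y b : ℂ) • v b

theorem norm_axisCoeff_sq_le [Nonempty Y] (v : Option Y → R) :
    ‖axisCoeff v‖ ^ 2 ≤ 2 * ∑ b, ‖v b‖ ^ 2 := by
  have h : ‖axisCoeff v‖ ≤ ∑ b, |axis Y b| * ‖v b‖ := by
    refine (norm_sum_le _ _).trans (le_of_eq ?_)
    simp [norm_smul]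
  calc ‖axisCoeff v‖ ^ 2 ≤ (∑ b, |axis Y b| * ‖v b‖) ^ 2 := by gcongr
    _ ≤ (∑ b, |axis Y b| ^ 2) * ∑ b, ‖v b‖ ^ 2 := sum_mul_sq_le_sq_mul_sq _ _ _
    _ = _ := by simp only [sq_abs, sum_axis_sq]

theorem sum_norm_sub_axisCoeff_sq [Nonempty Y] (v : Option Y → R) :
    ∑ b, ‖v b - (axis Y b : ℂ) • axisCoeff v‖ ^ 2 = ∑ b, ‖v b‖ ^ 2 := by
  -- Both `2 Re ⟨v, w ⊗ z⟩` and `‖w ⊗ z‖²` are `2 ‖z‖²`, where `z = axisCoeff v`.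
  have h1 : ∑ b, RCLike.re (inner ℂ (v b) ((axis Y b : ℂ) • axisCoeff v)) = ‖axisCoeff v‖ ^ 2 := by
    rw [← inner_self_eq_norm_sq (𝕜 := ℂ), ← map_sum]
    congr 1
    conv_rhs => rw [axisCoeff, sum_inner]
    refine sum_congr rfl fun b _ => ?_
    rw [inner_smul_left, inner_smul_right, Complex.conj_ofReal]
    rfl
  have h2 : ∑ b, ‖(axis Y b : ℂ) • axisCoeff v‖ ^ 2 = 2 * ‖axisCoeff v‖ ^ 2 := by
    simp only [norm_smul, mul_pow, ← sum_mul, Complex.norm_real, Real.norm_eq_abs, sq_abs,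
      sum_axis_sq]
  simp only [norm_sub_sq (𝕜 := ℂ)]
  rw [sum_add_distrib, sum_sub_distrib, ← mul_sum, h1, h2]
  ring

theorem axisCoeff_sub_axisCoeff [Nonempty Y] (v : Option Y → R) :
    axisCoeff (fun b => v b - (axis Y b : ℂ) • axisCoeff v) = -axisCoeff v := by
  have h : ∑ b, (axis Y b : ℂ) * (axis Y b : ℂ) = 2 := by
    have := sum_axis_sq (Y := Y)
    simp only [← pow_two]
    exact_mod_cast this
  conv_lhs => rw [axisCoeff]
  simp only [smul_sub, sum_sub_distrib, smul_smul, ← sum_smul, h]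
  rw [← axisCoeff, two_smul]
  abel

/-- The reflection `1 - w wᵀ` on the oracle register `x`, which exchanges `|none⟩` with the
uniform superposition of the `|some y⟩`. -/
noncomputable def compress (x : X) : Module.End ℂ (Reg X Y R) where
  toFun Ψ := WithLp.toLp 2 fun D =>
    Ψ D - (axis Y (D x) : ℂ) • axisCoeff fun b => Ψ (Function.update D x b)
  map_add' Ψ Φ := by
    ext D
    simp only [axisCoeff, PiLp.add_apply, smul_add, sum_add_distrib]
    abel
  map_smul' c Ψ := by
    ext D
    simp only [axisCoeff, PiLp.smul_apply, smul_sub, smul_sum, RingHom.id_apply]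
    congr 1
    exact sum_congr rfl fun b _ => by simp only [smul_smul]; congr 1; ring

theorem compress_apply (x : X) (Ψ : Reg X Y R) (D : X → Option Y) :
    compress x Ψ D
      = Ψ D - (axis Y (D x) : ℂ) • axisCoeff fun b => Ψ (Function.update D x b) := rfl

theorem compress_apply_update (x : X) (Ψ : Reg X Y R) (D : X → Option Y) (b : Option Y) :
    compress x Ψ (Function.update D x b) = Ψ (Function.update D x b)
      - (axis Y b : ℂ) • axisCoeff fun b => Ψ (Function.update D x b) := by
  simp [compress_apply]

theorem norm_compress [Nonempty Y] (x : X) (Ψ : Reg X Y R) : ‖compress x Ψ‖ = ‖Ψ‖ := by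
  have h : ∀ D, ∑ b, ‖compress x Ψ (Function.update D x b)‖ ^ 2
      = ∑ b, ‖Ψ (Function.update D x b)‖ ^ 2 := by
    intro D
    simp only [compress_apply_update]
    exact sum_norm_sub_axisCoeff_sq fun b => Ψ (Function.update D x b)
  rw [← sq_eq_sq₀ (norm_nonneg _) (norm_nonneg _), Reg.norm_sq, Reg.norm_sq]
  exact le_antisymm
    (sum_le_sum_of_fibres (g := fun D => ‖compress x Ψ D‖ ^ 2) (g' := fun D => ‖Ψ D‖ ^ 2) x
      fun D => (h D).le)
    (sum_le_sum_of_fibres (g := fun D => ‖Ψ D‖ ^ 2) (g' := fun D => ‖compress x Ψ D‖ ^ 2) x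
      fun D => (h D).ge)

theorem compress_mul_self [Nonempty Y] (x : X) :
    (compress x * compress x : Module.End ℂ (Reg X Y R)) = 1 := by
  ext Ψ D
  simp only [Module.End.mul_apply, Module.End.one_apply]
  rw [compress_apply]
  simp only [compress_apply_update]
  rw [axisCoeff_sub_axisCoeff, compress_apply, smul_neg]
  abel

theorem compress_commute (x y : X) :
    Commute (compress x : Module.End ℂ (Reg X Y R)) (compress y) := by
  rcases eq_or_ne x y with rfl | hxy
  · exact Commute.refl _
  ext Ψ D
  simp only [Module.End.mul_apply, compress_apply, axisCoeff, Function.update_of_ne hxy,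
    Function.update_of_ne hxy.symm, smul_sub, sum_sub_distrib, smul_sum]
  rw [sum_comm]
  simp only [Function.update_comm hxy, smul_smul]
  have : ∀ a b, ((axis Y (D x) : ℂ) * ((axis Y b) * (axis Y (D y) * axis Y a)))
    = ((axis Y (D y) : ℂ) * ((axis Y a) * (axis Y (D x) * axis Y b))) := fun a b => by ring
  simp only [this]
  abel

theorem compress_commute_diag {x : X} {V : (X → Option Y) → Module.End ℂ R}
    (hV : ∀ D b, V (Function.update D x b) = V D) :
    Commute (compress x) (diag V) := by
  ext Ψ D
  simp [Module.End.mul_apply, compress_apply, axisCoeff, hV]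

theorem compress_commute_mask {x : X} {S : Set (X → Option Y)}
    (hS : ∀ D b, Function.update D x b ∈ S ↔ D ∈ S) :
    Commute (compress x : Module.End ℂ (Reg X Y R)) (mask S) := by
  ext Ψ D
  by_cases h : D ∈ S <;> simp [Module.End.mul_apply, compress_apply, mask_apply, axisCoeff, hS, h]

/-! ### Leakage into a set of databases -/

/-- `A` leaks at most `c` into `S`: it maps a vector supported outside `S` to one whose part in
`S` has norm at most `c` times the norm of the vector. -/
def Leak (S : Set (X → Option Y)) (A : Module.End ℂ (Reg X Y R)) (c : ℝ) : Prop :=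
  ∀ Ψ, ‖mask S (A (mask Sᶜ Ψ))‖ ≤ c * ‖Ψ‖

theorem Leak.of_commute {S : Set (X → Option Y)} {A : Module.End ℂ (Reg X Y R)}
    (h : Commute A (mask S)) : Leak S A 0 := by
  intro Ψ
  rw [← Module.End.mul_apply, ← h.eq, Module.End.mul_apply, mask_mask_compl]
  simp

theorem Leak.mul {S : Set (X → Option Y)} {A B : Module.End ℂ (Reg X Y R)} {a b : ℝ}
    (hA : Leak S A a) (hB : Leak S B b) (hA1 : ∀ Ψ, ‖A Ψ‖ = ‖Ψ‖) (hB1 : ∀ Ψ, ‖B Ψ‖ = ‖Ψ‖)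
    (ha : 0 ≤ a) : Leak S (A * B) (a + b) := by
  intro Ψ
  -- Insert `mask S + mask Sᶜ = 1` between `A` and `B`.
  set Φ := B (mask Sᶜ Ψ)
  have h1 : ‖mask S (A (mask S Φ))‖ ≤ b * ‖Ψ‖ := by
    refine (norm_mask_le _ _).trans ?_
    rw [hA1]
    exact hB Ψ
  have h2 : ‖mask S (A (mask Sᶜ Φ))‖ ≤ a * ‖Ψ‖ := by
    refine (hA Φ).trans (mul_le_mul_of_nonneg_left ?_ ha)
    rw [hB1]
    exact norm_mask_le _ _
  calc ‖mask S ((A * B) (mask Sᶜ Ψ))‖ = ‖mask S (A (mask S Φ)) + mask S (A (mask Sᶜ Φ))‖ := by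
        rw [← map_add, ← map_add, mask_add_mask_compl]; rfl
    _ ≤ b * ‖Ψ‖ + a * ‖Ψ‖ := norm_add_le_of_le h1 h2
    _ = (a + b) * ‖Ψ‖ := by ring

theorem Leak.norm_sq_le {S : Set (X → Option Y)} {A : Module.End ℂ (Reg X Y R)} {c : ℝ}
    (hA : Leak S A c) {Ψ : Reg X Y R} (hΨ : mask S Ψ = 0) :
    ‖mask S (A Ψ)‖ ^ 2 ≤ c ^ 2 * ‖Ψ‖ ^ 2 := by
  have h := hA Ψ
  have h1 : mask Sᶜ Ψ = Ψ := by simpa [hΨ] using mask_add_mask_compl S Ψ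
  rw [h1] at h
  rw [← mul_pow]
  gcongr

open Classical in
/-- The amplitude that `compress x` creates at `some y` is `-w_y ∑_b w_b v_b`, of squared norm at
most `(1 / M) * 2 ‖v‖²`; there are at most `n` such `y` with the update in `S`. -/
theorem leak_compress [Nonempty Y] {S : Set (X → Option Y)} {x : X} {n : ℕ}
    (hnone : ∀ D ∈ S, D x ≠ none)
    (hcard : ∀ D, #{y : Y | Function.update D x (some y) ∈ S} ≤ n) :
    Leak S (compress x : Module.End ℂ (Reg X Y R)) √(2 * (n / Fintype.card Y)) := by
  intro Ψ
  refine le_of_sq_le_sq ?_ (by positivity)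
  rw [mul_pow, Real.sq_sqrt (by positivity), Reg.norm_sq, Reg.norm_sq, mul_sum]
  refine sum_le_sum_of_fibres
    (g := fun D => ‖mask S (compress x (mask Sᶜ Ψ)) D‖ ^ 2)
    (g' := fun D => 2 * ((n : ℝ) / Fintype.card Y) * ‖Ψ D‖ ^ 2) x fun D => ?_
  set v : Option Y → R := fun b => mask Sᶜ Ψ (Function.update D x b) with hv
  have hvΨ : ∑ b, ‖v b‖ ^ 2 ≤ ∑ b, ‖Ψ (Function.update D x b)‖ ^ 2 := by
    refine sum_le_sum fun b _ => ?_
    by_cases h : Function.update D x b ∈ S <;> simp [hv, mask_apply, h]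
  have hle : ∀ y, ‖mask S (compress x (mask Sᶜ Ψ)) (Function.update D x (some y))‖ ^ 2
      ≤ if Function.update D x (some y) ∈ S then
        1 / (Fintype.card Y : ℝ) * (2 * ∑ b, ‖v b‖ ^ 2) else 0 := by
    intro y
    rw [mask_apply]
    split_ifs with h
    · rw [compress_apply_update, mask_apply_notMem _ (by simpa using h), zero_sub, norm_neg,
        norm_smul, mul_pow, Complex.norm_real, Real.norm_eq_abs, sq_abs, axis_some_sq]
      gcongr
      exact norm_axisCoeff_sq_le v
    · simp
  have h0 : ‖mask S (compress x (mask Sᶜ Ψ)) (Function.update D x none)‖ ^ 2 = 0 := by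
    rw [mask_apply_notMem _ fun h => hnone _ h (by simp)]
    simp
  rw [Fintype.sum_option, h0, zero_add, ← mul_sum]
  calc _ ≤ _ := sum_le_sum fun y _ => hle y
    _ = #{y : Y | Function.update D x (some y) ∈ S}
        * (1 / (Fintype.card Y : ℝ) * (2 * ∑ b, ‖v b‖ ^ 2)) := by
      rw [← sum_filter, sum_const, nsmul_eq_mul]
    _ ≤ n * (1 / (Fintype.card Y : ℝ) * (2 * ∑ b, ‖Ψ (Function.update D x b)‖ ^ 2)) := by
      gcongr
      exact hcard D
    _ = _ := by ring

/-! ### The change of basis on all registers -/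

/-- The product of the reflections `compress x` over `x ∈ Q`. -/
noncomputable def compressOn (Q : Finset X) : Module.End ℂ (Reg X Y R) :=
  Q.noncommProd compress fun x _ y _ _ => compress_commute x y

theorem compressOn_insert {x : X} {Q : Finset X} (hx : x ∉ Q) :
    (compressOn (insert x Q) : Module.End ℂ (Reg X Y R)) = compress x * compressOn Q :=
  Finset.noncommProd_insert_of_notMem _ _ _ _ hx

theorem compressOn_univ (x : X) :
    (compressOn univ : Module.End ℂ (Reg X Y R)) = compress x * compressOn (univ.erase x) := by
  rw [← compressOn_insert (notMem_erase x univ), insert_erase (mem_univ x)]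

theorem compressOn_commute {Q : Finset X} {A : Module.End ℂ (Reg X Y R)}
    (h : ∀ x ∈ Q, Commute (compress x) A) : Commute (compressOn Q) A := by
  induction Q using Finset.induction_on with
  | empty => exact Commute.one_left _
  | insert x Q hx ih =>
    rw [compressOn_insert hx]
    exact (h x (mem_insert_self x Q)).mul_left (ih fun y hy => h y (mem_insert_of_mem hy))

theorem norm_compressOn [Nonempty Y] (Q : Finset X) (Ψ : Reg X Y R) :
    ‖compressOn Q Ψ‖ = ‖Ψ‖ := by
  induction Q using Finset.induction_on with
  | empty => rfl
  | insert x Q hx ih => rw [compressOn_insert hx, Module.End.mul_apply, norm_compress, ih]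

theorem compressOn_mul_self [Nonempty Y] (Q : Finset X) :
    (compressOn Q * compressOn Q : Module.End ℂ (Reg X Y R)) = 1 := by
  induction Q using Finset.induction_on with
  | empty => rfl
  | insert x Q hx ih =>
    have h : Commute (compressOn Q : Module.End ℂ (Reg X Y R)) (compress x) :=
      compressOn_commute fun y _ => compress_commute y x
    rw [compressOn_insert hx, mul_assoc, ← mul_assoc (compressOn Q), h.eq, mul_assoc, ih, mul_one,
      compress_mul_self]

theorem compressOn_compressOn [Nonempty Y] (Q : Finset X) (Ψ : Reg X Y R) :
    compressOn Q (compressOn Q Ψ) = Ψ := by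
  rw [← Module.End.mul_apply, compressOn_mul_self, Module.End.one_apply]

theorem leak_compressOn [Nonempty Y] {S : Set (X → Option Y)} {c : X → ℝ} (hc : ∀ x, 0 ≤ c x)
    (h : ∀ x, Leak S (compress x : Module.End ℂ (Reg X Y R)) (c x)) (Q : Finset X) :
    Leak S (compressOn Q : Module.End ℂ (Reg X Y R)) (∑ x ∈ Q, c x) := by
  induction Q using Finset.induction_on with
  | empty => exact Leak.of_commute (Commute.one_left _)
  | insert x Q hx ih =>
    rw [compressOn_insert hx, sum_insert hx]
    exact (h x).mul ih (norm_compress x) (norm_compressOn Q) (hc x)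

/-- An operator controlled by the register `x` alone feels only the change of basis on that
register. -/
theorem compressOn_univ_conj_diag [Nonempty Y] {x : X} {V : (X → Option Y) → Module.End ℂ R}
    (hV : ∀ z ≠ x, ∀ D b, V (Function.update D z b) = V D) :
    compressOn univ * diag V * compressOn univ = compress x * diag V * compress x := by
  have h1 : Commute (compressOn (univ.erase x)) (diag V) :=
    compressOn_commute fun z hz => compress_commute_diag (hV z (ne_of_mem_erase hz))
  have h2 : Commute (compressOn (univ.erase x) : Module.End ℂ (Reg X Y R)) (compress x) :=
    compressOn_commute fun z _ => compress_commute z x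
  calc compressOn univ * diag V * compressOn univ
      = compress x * (compressOn (univ.erase x) * diag V)
        * (compress x * compressOn (univ.erase x)) := by
        rw [compressOn_univ x, mul_assoc (compress x)]
    _ = compress x * diag V * (compressOn (univ.erase x) * compressOn (univ.erase x))
        * compress x := by
        rw [h1.eq, ← h2.eq]; simp only [mul_assoc]
    _ = _ := by rw [compressOn_mul_self, mul_one]

end Registers

section Databases

variable {X Y Z R : Type*}

/-! ### Databases with a collision, large databases -/

/-- The databases that have values at `x` and at `x'` which collide under `f`. -/
def pairCollision (f : X × Y → Z) (x x' : X) : Set (X → Option Y) :=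
  {D | ∃ y y', D x = some y ∧ D x' = some y' ∧ f (x, y) = f (x', y')}

theorem pairCollision_symm (f : X × Y → Z) (x x' : X) :
    pairCollision f x x' = pairCollision f x' x := by
  ext D
  constructor <;> rintro ⟨y, y', h, h', e⟩ <;> exact ⟨y', y, h', h, e.symm⟩

/-- The databases with a generalized collision. -/
def collision (f : X × Y → Z) : Set (X → Option Y) :=
  {D | ∃ x x', x ≠ x' ∧ D ∈ pairCollision f x x'}

theorem pairCollision_subset_collision (f : X × Y → Z) {x x' : X} (h : x ≠ x') :
    pairCollision f x x' ⊆ collision f :=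
  fun _ hD => ⟨x, x', h, hD⟩

/-- The databases with a generalized collision between two inputs outside `Q`. -/
def collisionOff (f : X × Y → Z) (Q : Finset X) : Set (X → Option Y) :=
  {D | ∃ x ∉ Q, ∃ x' ∉ Q, x ≠ x' ∧ D ∈ pairCollision f x x'}

variable [DecidableEq X]

theorem update_mem_pairCollision (f : X × Y → Z) {x x' z : X} (h : z ≠ x) (h' : z ≠ x')
    (D : X → Option Y) (b : Option Y) :
    Function.update D z b ∈ pairCollision f x x' ↔ D ∈ pairCollision f x x' := by
  simp [pairCollision, Function.update_of_ne h.symm, Function.update_of_ne h'.symm]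

theorem update_mem_collisionOff (f : X × Y → Z) {Q : Finset X} {z : X} (hz : z ∈ Q)
    (D : X → Option Y) (b : Option Y) :
    Function.update D z b ∈ collisionOff f Q ↔ D ∈ collisionOff f Q := by
  refine exists_congr fun x => and_congr_right fun hx => exists_congr fun x' =>
    and_congr_right fun hx' => and_congr_right fun _ => ?_
  exact update_mem_pairCollision f (ne_of_mem_of_not_mem hz hx) (ne_of_mem_of_not_mem hz hx') D b

variable [Fintype X]

/-- The number of filled registers outside `Q`; the size of the database if `Q = ∅`. -/
def sizeOff (Q : Finset X) (D : X → Option Y) : ℕ := #{x | x ∉ Q ∧ (D x).isSome}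

/-- The databases with more than `n` filled registers outside `Q`. -/
def largeOff (Q : Finset X) (n : ℕ) : Set (X → Option Y) := {D | n < sizeOff Q D}

/-- The databases in which `x` collides with an input outside `Q`, at most `n` registers outside
`Q` being filled. The bound on the size is part of the event in order to bound its leakage. -/
def collisionAt (f : X × Y → Z) (Q : Finset X) (n : ℕ) (x : X) : Set (X → Option Y) :=
  {D | sizeOff Q D ≤ n ∧ ∃ x' ∉ Q, D ∈ pairCollision f x x'}

theorem sizeOff_update {Q : Finset X} {z : X} (hz : z ∈ Q) (D : X → Option Y) (b : Option Y) :
    sizeOff Q (Function.update D z b) = sizeOff Q D := by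
  unfold sizeOff
  congr 1
  ext x
  simp only [mem_filter, mem_univ, true_and, and_congr_right_iff]
  intro hx
  rw [Function.update_of_ne (ne_of_mem_of_not_mem hz hx).symm]

theorem sizeOff_empty_le (Q : Finset X) (D : X → Option Y) :
    sizeOff ∅ D ≤ sizeOff Q D + #Q := by
  unfold sizeOff
  refine (card_le_card ?_).trans (card_union_le _ _)
  intro x
  by_cases hx : x ∈ Q <;> simp [hx]

theorem sizeOff_le_sizeOff_empty (Q : Finset X) (D : X → Option Y) :
    sizeOff Q D ≤ sizeOff ∅ D :=
  card_le_card fun x => by simp +contextual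

theorem update_mem_largeOff {Q : Finset X} {n : ℕ} {z : X} (hz : z ∈ Q)
    (D : X → Option Y) (b : Option Y) :
    Function.update D z b ∈ largeOff Q n ↔ D ∈ largeOff Q n := by
  simp [largeOff, sizeOff_update hz]

theorem update_mem_collisionAt (f : X × Y → Z) {Q : Finset X} {n : ℕ} {x z : X} (hz : z ∈ Q)
    (hzx : z ≠ x) (D : X → Option Y) (b : Option Y) :
    Function.update D z b ∈ collisionAt f Q n x ↔ D ∈ collisionAt f Q n x := by
  unfold collisionAt
  simp only [Set.mem_ofPred_eq, sizeOff_update hz]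
  refine and_congr_right fun _ => exists_congr fun x' => and_congr_right fun hx' => ?_
  exact update_mem_pairCollision f hzx (ne_of_mem_of_not_mem hz hx') D b

/-- A collision in a small database lies outside `Q`, crosses its boundary, or lies inside `Q`. -/
theorem collision_subset (f : X × Y → Z) (Q : Finset X) (n : ℕ) :
    collision f ⊆ ((largeOff Q n ∪ collisionOff f Q) ∪ ⋃ x ∈ Q, collisionAt f Q n x)
      ∪ ⋃ p ∈ Q.offDiag, pairCollision f p.1 p.2 := by
  rintro D ⟨x, x', hne, hD⟩
  by_cases hn : n < sizeOff Q D
  · exact Or.inl (Or.inl (Or.inl hn))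
  push Not at hn
  by_cases hx : x ∈ Q <;> by_cases hx' : x' ∈ Q
  · exact Or.inr (Set.mem_biUnion (x := (x, x')) (by simp [hx, hx', hne]) hD)
  · exact Or.inl (Or.inr (Set.mem_biUnion (x := x) hx ⟨hn, x', hx', hD⟩))
  · rw [pairCollision_symm] at hD
    exact Or.inl (Or.inr (Set.mem_biUnion (x := x') hx' ⟨hn, x, hx, hD⟩))
  · exact Or.inl (Or.inl (Or.inr ⟨x, hx, x', hx', hne, hD⟩))

variable [Fintype Y]

open Classical in
omit [DecidableEq X] in
theorem card_fibre_le_Gam (f : X × Y → Z) {x x' : X} (h : x ≠ x') (y' : Y) :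
    #{y | f (x, y) = f (x', y')} ≤ Gam f := by
  have h1 := Finset.le_sup (f := fun t : X × X × Y =>
    (Finset.univ.filter fun y : Y => f (t.1, y) = f (t.2.1, t.2.2)).card)
    (mem_filter.2 ⟨mem_univ (x, x', y'), h⟩ :
      (x, x', y') ∈ Finset.univ.filter fun t : X × X × Y => t.1 ≠ t.2.1)
  unfold Gam
  exact h1

open Classical in
theorem card_update_mem_pairCollision_le (f : X × Y → Z) {x x' : X} (h : x ≠ x')
    (D : X → Option Y) :
    #{y : Y | Function.update D x (some y) ∈ pairCollision f x x'} ≤ Gam f := by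
  rcases hD : D x' with _ | y'
  · simp [pairCollision, Function.update_of_ne h.symm, hD]
  · refine (card_le_card ?_).trans (card_fibre_le_Gam f h y')
    intro y
    simp [pairCollision, Function.update_of_ne h.symm, hD]

open Classical in
theorem card_update_mem_collisionAt_le (f : X × Y → Z) {Q : Finset X} (n : ℕ) {x : X}
    (hx : x ∈ Q) (D : X → Option Y) :
    #{y : Y | Function.update D x (some y) ∈ collisionAt f Q n x} ≤ n * Gam f := by
  by_cases hn : sizeOff Q D ≤ n
  · refine le_trans ?_ (Nat.mul_le_mul_right _ hn)
    refine le_trans (card_le_card (t := ({x' | x' ∉ Q ∧ (D x').isSome} : Finset X).biUnion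
      fun x' => {y : Y | Function.update D x (some y) ∈ pairCollision f x x'}) ?_)
      (card_biUnion_le_card_mul _ _ _ fun x' hx' => ?_)
    · intro y hy
      simp only [mem_filter, mem_univ, true_and] at hy
      obtain ⟨_, x', hx', hD⟩ := hy
      simp only [mem_biUnion, mem_filter, mem_univ, true_and]
      refine ⟨x', ⟨hx', ?_⟩, hD⟩
      obtain ⟨_, y', _, h, _⟩ := hD
      rw [Function.update_of_ne (ne_of_mem_of_not_mem hx hx').symm] at h
      simp [h]
    · simp only [mem_filter, mem_univ, true_and] at hx'
      exact card_update_mem_pairCollision_le f (ne_of_mem_of_not_mem hx hx'.1) D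
  · simp [collisionAt, sizeOff_update hx, hn]

variable [NormedAddCommGroup R] [InnerProductSpace ℂ R] [Nonempty Y]

theorem leak_compress_pairCollision (f : X × Y → Z) {x x' : X} (h : x ≠ x') (z : X) :
    Leak (pairCollision f x x') (compress z : Module.End ℂ (Reg X Y R))
      (if z = x ∨ z = x' then √(2 * (Gam f / Fintype.card Y)) else 0) := by
  split_ifs with hz
  · rcases hz with rfl | rfl
    · refine leak_compress (fun D hD => ?_) (card_update_mem_pairCollision_le f h)
      obtain ⟨y, _, hy, _⟩ := hD
      simp [hy]
    · rw [pairCollision_symm]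
      refine leak_compress (fun D hD => ?_) (card_update_mem_pairCollision_le f h.symm)
      obtain ⟨y, _, hy, _⟩ := hD
      simp [hy]
  · push Not at hz
    exact Leak.of_commute (compress_commute_mask (update_mem_pairCollision f hz.1 hz.2))

theorem leak_compress_collisionAt (f : X × Y → Z) {Q : Finset X} (n : ℕ) {x z : X} (hx : x ∈ Q)
    (hz : z ∈ Q) :
    Leak (collisionAt f Q n x) (compress z : Module.End ℂ (Reg X Y R))
      (if z = x then √(2 * ((n * Gam f : ℕ) / Fintype.card Y)) else 0) := by
  split_ifs with hzx
  · subst hzx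
    refine leak_compress (fun D hD => ?_) (card_update_mem_collisionAt_le f n hx)
    obtain ⟨_, _, _, y, _, hy, _⟩ := hD
    simp [hy]
  · exact Leak.of_commute (compress_commute_mask (update_mem_collisionAt f hz hzx))

end Databases

section Oracle

variable {X Y : Type*} {k d : ℕ}

/-! ### Label projections and the query -/

open Classical in
/-- The projection of the state of the algorithm onto the basis labels in `s`. -/
noncomputable def restr (s : Set (Label X Y k d)) : Module.End ℂ (StateSpace X Y k d) where
  toFun ψ := WithLp.toLp 2 fun b => if b ∈ s then ψ b else 0
  map_add' ψ φ := by
    ext b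
    by_cases h : b ∈ s <;> simp [h]
  map_smul' c ψ := by
    ext b
    by_cases h : b ∈ s <;> simp [h]

open Classical in
theorem restr_apply (s : Set (Label X Y k d)) (ψ : StateSpace X Y k d) (b : Label X Y k d) :
    restr s ψ b = if b ∈ s then ψ b else 0 := rfl

section

variable [Fintype X] [Fintype Y]

theorem norm_restr_le (s : Set (Label X Y k d)) (ψ : StateSpace X Y k d) :
    ‖restr s ψ‖ ≤ ‖ψ‖ := by
  refine le_of_sq_le_sq ?_ (norm_nonneg _)
  rw [EuclideanSpace.norm_sq_eq, EuclideanSpace.norm_sq_eq]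
  refine sum_le_sum fun b _ => ?_
  by_cases h : b ∈ s <;> simp [restr_apply, h]

variable [DecidableEq X]

/-- The projection onto the labels `b` of the algorithm with `g b = j`. -/
noncomputable def sector {J : Type*} (g : Label X Y k d → J) (j : J) :
    Module.End ℂ (Reg X Y (StateSpace X Y k d)) :=
  diag fun _ => restr {b | g b = j}

theorem sum_norm_sector_sq {J : Type*} [Fintype J] (g : Label X Y k d → J)
    (Ψ : Reg X Y (StateSpace X Y k d)) : ∑ j, ‖sector g j Ψ‖ ^ 2 = ‖Ψ‖ ^ 2 := by
  classical
  simp only [Reg.norm_sq, sector, diag_apply, EuclideanSpace.norm_sq_eq, restr_apply]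
  rw [sum_comm]
  refine sum_congr rfl fun D _ => ?_
  rw [sum_comm]
  refine sum_congr rfl fun b _ => ?_
  rw [sum_eq_single (g b)]
  · simp
  · intro j _ hj
    simp [hj.symm]
  · simp

theorem mask_sector {J : Type*} (S : Set (X → Option Y)) (g : Label X Y k d → J) (j : J)
    (Ψ : Reg X Y (StateSpace X Y k d)) : mask S (sector g j Ψ) = sector g j (mask S Ψ) :=
  mask_diag S _ Ψ

theorem compressOn_commute_sector {J : Type*} (g : Label X Y k d → J) (j : J) (Q : Finset X) :
    Commute (compressOn Q) (sector g j) :=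
  compressOn_commute fun _ _ => compress_commute_diag fun _ _ => rfl

end

variable [AddCommGroup Y]

/-- The translation of the output registers of the algorithm by `a`. -/
noncomputable def shift (a : Fin k → Y) : Module.End ℂ (StateSpace X Y k d) where
  toFun ψ := WithLp.toLp 2 fun b => ψ (b.1, b.2.1 - a, b.2.2)
  map_add' _ _ := rfl
  map_smul' _ _ := rfl

theorem shift_apply (a : Fin k → Y) (ψ : StateSpace X Y k d) (b : Label X Y k d) :
    shift a ψ b = ψ (b.1, b.2.1 - a, b.2.2) := rfl

theorem shift_add (a a' : Fin k → Y) :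
    (shift (a + a') : Module.End ℂ (StateSpace X Y k d)) = shift a * shift a' := by
  ext ψ b
  simp only [Module.End.mul_apply, shift_apply, sub_sub]

variable [Fintype X] [Fintype Y]

theorem norm_shift (a : Fin k → Y) (ψ : StateSpace X Y k d) : ‖shift a ψ‖ = ‖ψ‖ := by
  rw [← sq_eq_sq₀ (norm_nonneg _) (norm_nonneg _), EuclideanSpace.norm_sq_eq,
    EuclideanSpace.norm_sq_eq]
  exact Equiv.sum_comp
    (Equiv.prodCongr (Equiv.refl _) (Equiv.prodCongr (Equiv.subRight a) (Equiv.refl _)))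
    fun b => ‖ψ b‖ ^ 2

theorem query_apply (H : X → Y) (ψ : StateSpace X Y k d) (b : Label X Y k d) :
    query k d H ψ b = ψ (b.1, fun i => b.2.1 i - H (b.1 i), b.2.2) := rfl

variable [DecidableEq X]

/-- The query controlled by the oracle registers, where an empty register is read as the value
`0`. -/
noncomputable def oracle (k d : ℕ) : Module.End ℂ (Reg X Y (StateSpace X Y k d)) :=
  diag fun D => (query k d fun x => (D x).getD 0).toLinearEquiv.toLinearMap

/-- The part of the query that reads the oracle registers in `Q`, when the input registers of the
algorithm hold `xs`. An oracle register is read once for all positions `i` with the same `xs i`.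
-/
noncomputable def oracleAt (d : ℕ) (xs : Fin k → X) (Q : Finset X) :
    Module.End ℂ (Reg X Y (StateSpace X Y k d)) :=
  diag fun D => shift fun i => if xs i ∈ Q then (D (xs i)).getD 0 else 0

theorem norm_oracle (Ψ : Reg X Y (StateSpace X Y k d)) : ‖oracle k d Ψ‖ = ‖Ψ‖ :=
  norm_diag (fun _ ψ => LinearIsometryEquiv.norm_map _ ψ) Ψ

theorem norm_oracleAt (xs : Fin k → X) (Q : Finset X) (Ψ : Reg X Y (StateSpace X Y k d)) :
    ‖oracleAt d xs Q Ψ‖ = ‖Ψ‖ :=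
  norm_diag (fun _ ψ => norm_shift _ ψ) Ψ

theorem oracleAt_empty (xs : Fin k → X) :
    (oracleAt d xs ∅ : Module.End ℂ (Reg X Y (StateSpace X Y k d))) = 1 := by
  ext Ψ D b
  simp only [oracleAt, diag_apply, shift_apply, notMem_empty, if_false, Module.End.one_apply]
  rw [show (fun _ : Fin k => (0 : Y)) = 0 from rfl, sub_zero]

theorem oracleAt_insert (xs : Fin k → X) {x : X} {Q : Finset X} (hx : x ∉ Q) :
    (oracleAt d xs (insert x Q) : Module.End ℂ (Reg X Y (StateSpace X Y k d)))
      = oracleAt d xs {x} * oracleAt d xs Q := by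
  ext Ψ D : 2
  simp only [oracleAt, diag_apply, Module.End.mul_apply]
  rw [← Module.End.mul_apply, ← shift_add]
  congr 2
  funext i
  by_cases h : xs i = x
  · simp [h, hx]
  · simp [h]

theorem sector_oracle (xs : Fin k → X) (Ψ : Reg X Y (StateSpace X Y k d)) :
    sector Prod.fst xs (oracle k d Ψ)
      = oracleAt d xs (univ.image xs) (sector Prod.fst xs Ψ) := by
  ext D b
  simp only [sector, oracle, oracleAt, diag_apply, restr_apply, shift_apply, mem_image, mem_univ,
    true_and, exists_apply_eq_apply, if_true, Set.mem_ofPred_eq]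
  by_cases h : b.1 = xs
  · simp only [h, if_true, LinearEquiv.coe_coe, LinearIsometryEquiv.coe_toLinearEquiv,
      query_apply]
    rfl
  · simp [h]

/-! ### The compressed query -/

/-- The query in the basis of databases. -/
noncomputable def compressedQuery (k d : ℕ) : Module.End ℂ (Reg X Y (StateSpace X Y k d)) :=
  compressOn univ * oracle k d * compressOn univ

/-- The part `oracleAt d xs Q` of the query in the basis of databases. -/
noncomputable def compressedQueryAt (d : ℕ) (xs : Fin k → X) (Q : Finset X) :
    Module.End ℂ (Reg X Y (StateSpace X Y k d)) :=
  compressOn univ * oracleAt d xs Q * compressOn univ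

theorem norm_compressedQuery (Ψ : Reg X Y (StateSpace X Y k d)) :
    ‖compressedQuery k d Ψ‖ = ‖Ψ‖ := by
  simp [compressedQuery, Module.End.mul_apply, norm_compressOn, norm_oracle]

theorem norm_compressedQueryAt (xs : Fin k → X) (Q : Finset X)
    (Ψ : Reg X Y (StateSpace X Y k d)) : ‖compressedQueryAt d xs Q Ψ‖ = ‖Ψ‖ := by
  simp [compressedQueryAt, Module.End.mul_apply, norm_compressOn, norm_oracleAt]

theorem sector_compressedQuery (xs : Fin k → X) (Ψ : Reg X Y (StateSpace X Y k d)) :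
    sector Prod.fst xs (compressedQuery k d Ψ)
      = compressedQueryAt d xs (univ.image xs) (sector Prod.fst xs Ψ) := by
  have h : ∀ Φ : Reg X Y (StateSpace X Y k d), sector Prod.fst xs (compressOn univ Φ)
      = compressOn univ (sector Prod.fst xs Φ) := fun Φ =>
    (LinearMap.congr_fun (compressOn_commute_sector Prod.fst xs univ).eq Φ).symm
  simp only [compressedQuery, compressedQueryAt, Module.End.mul_apply, h, sector_oracle]

/-- As the query preserves the input registers, it suffices to bound its effect for fixed inputs
`xs`. -/
theorem norm_mask_compressedQuery_sq_le {S : Set (X → Option Y)} {c : ℝ}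
    {Ψ : Reg X Y (StateSpace X Y k d)}
    (h : ∀ xs : Fin k → X,
      ‖mask S (compressedQueryAt d xs (univ.image xs) (sector Prod.fst xs Ψ))‖ ^ 2
        ≤ c * ‖sector Prod.fst xs Ψ‖ ^ 2) :
    ‖mask S (compressedQuery k d Ψ)‖ ^ 2 ≤ c * ‖Ψ‖ ^ 2 := by
  rw [← sum_norm_sector_sq Prod.fst (mask S _), ← sum_norm_sector_sq Prod.fst Ψ, mul_sum]
  refine sum_le_sum fun xs _ => ?_
  refine le_trans (le_of_eq ?_) (h xs)
  rw [← sector_compressedQuery]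
  simp only [sector, mask_diag]

/-- For fixed inputs, the compressed query is a product of operators acting on single registers.
-/
theorem compressedQueryAt_insert (xs : Fin k → X) {x : X} {Q : Finset X} (hx : x ∉ Q) :
    (compressedQueryAt d xs (insert x Q) : Module.End ℂ (Reg X Y (StateSpace X Y k d)))
      = (compress x * oracleAt d xs {x} * compress x) * compressedQueryAt d xs Q := by
  have h : (compressOn univ * oracleAt d xs {x} * compressOn univ
      : Module.End ℂ (Reg X Y (StateSpace X Y k d)))
      = compress x * oracleAt d xs {x} * compress x := by
    refine compressOn_univ_conj_diag fun z hz D b => ?_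
    congr 1
    ext i
    split_ifs with hi
    · rw [Function.update_of_ne]
      rw [mem_singleton.1 hi]
      exact hz.symm
    · rfl
  rw [← h, compressedQueryAt, compressedQueryAt, oracleAt_insert xs hx]
  calc compressOn univ * (oracleAt d xs {x} * oracleAt d xs Q) * compressOn univ
      = compressOn univ * oracleAt d xs {x} * 1 * oracleAt d xs Q * compressOn univ := by
        simp only [mul_assoc, one_mul]
    _ = _ := by rw [← compressOn_mul_self univ]; simp only [mul_assoc]

theorem leak_compressedQueryAt {S : Set (X → Option Y)} {c : X → ℝ} (hc : ∀ x, 0 ≤ c x)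
    (xs : Fin k → X) {Q : Finset X}
    (h : ∀ x ∈ Q, Leak S
      (compress x : Module.End ℂ (Reg X Y (StateSpace X Y k d))) (c x)) :
    Leak S (compressedQueryAt d xs Q : Module.End ℂ (Reg X Y (StateSpace X Y k d)))
      (∑ x ∈ Q, 2 * c x) := by
  induction Q using Finset.induction_on with
  | empty =>
    rw [compressedQueryAt, oracleAt_empty, mul_one, compressOn_mul_self]
    exact Leak.of_commute (Commute.one_left _)
  | insert x Q hx ih =>
    rw [compressedQueryAt_insert xs hx, sum_insert hx]
    -- `oracleAt` is diagonal, so only the two reflections around it leak.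
    have hx1 := h x (mem_insert_self x Q)
    have h0 : Leak S (oracleAt d xs {x} : Module.End ℂ (Reg X Y (StateSpace X Y k d))) 0 :=
      Leak.of_commute (LinearMap.ext fun Ψ => (mask_diag S _ Ψ).symm)
    have h1 := hx1.mul h0 (norm_compress x) (norm_oracleAt xs {x}) (hc x)
    have hn : ∀ Ψ : Reg X Y (StateSpace X Y k d),
        ‖(compress x * oracleAt d xs {x} : Module.End ℂ (Reg X Y (StateSpace X Y k d))) Ψ‖
          = ‖Ψ‖ := fun Ψ => by
      rw [Module.End.mul_apply, norm_compress, norm_oracleAt]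
    have h2 := h1.mul hx1 hn (norm_compress x) (by simpa using hc x)
    have h3 := h2.mul (ih fun y hy => h y (mem_insert_of_mem hy))
      (fun Ψ => by rw [Module.End.mul_apply, hn, norm_compress]) (norm_compressedQueryAt xs Q)
      (by linarith [hc x])
    convert h3 using 1
    ring

end Oracle

section Transition

variable {X Y Z : Type*} [Fintype X] [DecidableEq X] [Fintype Y] [AddCommGroup Y] {k d : ℕ}

/-! ### One query rarely creates a collision -/

theorem leak_compressedQueryAt_of_update {S : Set (X → Option Y)} (xs : Fin k → X) {Q : Finset X}
    (hS : ∀ z ∈ Q, ∀ D b, Function.update D z b ∈ S ↔ D ∈ S) :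
    Leak S (compressedQueryAt d xs Q : Module.End ℂ (Reg X Y (StateSpace X Y k d))) 0 := by
  have h := leak_compressedQueryAt (d := d) (S := S) (c := fun _ => 0) (fun _ => le_rfl) xs
    (Q := Q) fun z hz => Leak.of_commute (compress_commute_mask (hS z hz))
  simpa using h

/-- The number of filled registers outside the queried ones does not increase. -/
theorem mask_largeOff_compressedQueryAt {n : ℕ} (xs : Fin k → X) (Q : Finset X)
    {Ψ : Reg X Y (StateSpace X Y k d)} (hΨ : mask (largeOff ∅ n) Ψ = 0) :
    mask (largeOff Q n) (compressedQueryAt d xs Q Ψ) = 0 := by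
  have h := (leak_compressedQueryAt_of_update (d := d) (S := largeOff Q n) xs
    fun z hz => update_mem_largeOff hz).norm_sq_le
    (mask_eq_zero_mono (fun D hD => lt_of_lt_of_le hD (sizeOff_le_sizeOff_empty Q D)) hΨ)
  exact norm_eq_zero.1 (pow_eq_zero_iff two_ne_zero |>.1 (le_antisymm (by simpa using h)
    (sq_nonneg _)))

theorem mask_largeOff_compressedQuery {n : ℕ}
    {Ψ : Reg X Y (StateSpace X Y k d)} (hΨ : mask (largeOff ∅ n) Ψ = 0) :
    mask (largeOff ∅ (n + k)) (compressedQuery k d Ψ) = 0 := by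
  have h : ‖mask (largeOff ∅ (n + k)) (compressedQuery k d Ψ)‖ ^ 2 ≤ 0 * ‖Ψ‖ ^ 2 := by
    refine norm_mask_compressedQuery_sq_le fun xs => ?_
    rw [mask_eq_zero_mono (T := largeOff (univ.image xs) n)]
    · simp
    · intro D (hD : n + k < sizeOff ∅ D)
      have h1 := sizeOff_empty_le (univ.image xs) D
      have h2 : #(univ.image xs) ≤ k := card_image_le.trans (by simp)
      show n < sizeOff _ D
      omega
    · exact mask_largeOff_compressedQueryAt xs _ (by rw [mask_sector, hΨ, map_zero])
  exact norm_eq_zero.1 (pow_eq_zero_iff two_ne_zero |>.1 (le_antisymm (by simpa using h)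
    (sq_nonneg _)))

theorem norm_mask_collision_compressedQueryAt_sq_le (f : X × Y → Z) {n : ℕ} (xs : Fin k → X)
    (Q : Finset X) {Ψ : Reg X Y (StateSpace X Y k d)} (hc : mask (collision f) Ψ = 0)
    (hn : mask (largeOff ∅ n) Ψ = 0) :
    ‖mask (collision f) (compressedQueryAt d xs Q Ψ)‖ ^ 2
      ≤ (8 * n * #Q + 32 * #Q ^ 2) * (Gam f / Fintype.card Y) * ‖Ψ‖ ^ 2 := by
  set g : ℝ := Gam f / Fintype.card Y with hg
  have hg0 : 0 ≤ g := by positivity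
  set Φ := compressedQueryAt d xs Q Ψ with hΦ
  -- These events depend only on registers outside `Q`, which the operator does not touch.
  have h0 : ‖mask (largeOff Q n ∪ collisionOff f Q) Φ‖ ^ 2 ≤ 0 := by
    refine (norm_mask_union_sq_le _ _ _).trans ?_
    rw [mask_largeOff_compressedQueryAt xs Q hn, norm_zero]
    have h := (leak_compressedQueryAt_of_update (d := d) (S := collisionOff f Q) xs
      fun z hz => update_mem_collisionOff f hz).norm_sq_le (Ψ := Ψ) (mask_eq_zero_mono
        (fun _ hD => by
          obtain ⟨x, _, x', _, h, hD⟩ := hD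
          exact pairCollision_subset_collision f h hD) hc)
    simpa using h
  have h1 : ∀ x ∈ Q, ‖mask (collisionAt f Q n x) Φ‖ ^ 2 ≤ 8 * n * g * ‖Ψ‖ ^ 2 := by
    intro x hx
    have hl := leak_compressedQueryAt (d := d) (S := collisionAt f Q n x)
      (c := fun z => if z = x then √(2 * ((n * Gam f : ℕ) / Fintype.card Y)) else 0)
      (fun z => by positivity) xs fun z hz => leak_compress_collisionAt f n hx hz
    refine (hl.norm_sq_le (mask_eq_zero_mono
      (fun _ hD => by
        obtain ⟨_, x', hx', hD⟩ := hD
        exact pairCollision_subset_collision f (ne_of_mem_of_not_mem hx hx') hD) hc)).trans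
      (le_of_eq ?_)
    rw [← mul_sum, sum_ite_eq' Q x, if_pos hx, mul_pow, Real.sq_sqrt (by positivity), hg]
    push_cast
    ring
  have h2 : ∀ p ∈ Q.offDiag, ‖mask (pairCollision f p.1 p.2) Φ‖ ^ 2 ≤ 32 * g * ‖Ψ‖ ^ 2 := by
    rintro ⟨x, x'⟩ hp
    obtain ⟨hx, hx', hne⟩ := mem_offDiag.1 hp
    have hl := leak_compressedQueryAt (d := d) (S := pairCollision f x x')
      (c := fun z => if z = x ∨ z = x' then √(2 * g) else 0)
      (fun z => by positivity) xs (Q := Q) fun z _ => leak_compress_pairCollision f hne z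
    refine (hl.norm_sq_le
      (mask_eq_zero_mono (pairCollision_subset_collision f hne) hc)).trans (le_of_eq ?_)
    have hQ : {z ∈ Q | z = x ∨ z = x'} = {x, x'} := by
      ext z
      simp only [mem_filter, mem_insert, mem_singleton]
      exact ⟨fun h => h.2, fun h => ⟨by rcases h with rfl | rfl <;> assumption, h⟩⟩
    rw [← mul_sum, ← sum_filter, hQ, sum_const, card_pair hne, nsmul_eq_mul, mul_pow, mul_pow,
      Real.sq_sqrt (by positivity)]
    push_cast
    ring
  calc ‖mask (collision f) Φ‖ ^ 2
      ≤ 0 + ∑ x ∈ Q, 8 * n * g * ‖Ψ‖ ^ 2 + ∑ p ∈ Q.offDiag, 32 * g * ‖Ψ‖ ^ 2 := by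
        refine (norm_mask_sq_le_of_subset (collision_subset f Q n) Φ).trans ?_
        refine (norm_mask_union_sq_le _ _ _).trans (add_le_add ?_ ?_)
        · refine (norm_mask_union_sq_le _ _ _).trans (add_le_add h0 ?_)
          exact (norm_mask_biUnion_sq_le _ _ _).trans (sum_le_sum h1)
        · exact (norm_mask_biUnion_sq_le _ (fun p : X × X => pairCollision f p.1 p.2) _).trans
            (sum_le_sum h2)
    _ ≤ 0 + #Q * (8 * n * g * ‖Ψ‖ ^ 2) + #Q ^ 2 * (32 * g * ‖Ψ‖ ^ 2) := by
        rw [sum_const, sum_const, nsmul_eq_mul, nsmul_eq_mul]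
        gcongr
        rw [offDiag_card, pow_two]
        exact_mod_cast Nat.sub_le _ _
    _ = _ := by ring

theorem norm_mask_collision_compressedQuery_le (f : X × Y → Z) {n : ℕ}
    {Ψ : Reg X Y (StateSpace X Y k d)} (hn : mask (largeOff ∅ n) Ψ = 0) :
    ‖mask (collision f) (compressedQuery k d Ψ)‖ ≤ ‖mask (collision f) Ψ‖
      + √((8 * n * k + 32 * k ^ 2) * (Gam f / Fintype.card Y)) * ‖Ψ‖ := by
  set g : ℝ := Gam f / Fintype.card Y
  have hg0 : 0 ≤ g := by positivity
  set Θ := mask (collision f)ᶜ Ψ with hΘ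
  have hΘc : mask (collision f) Θ = 0 := mask_mask_compl _ _
  have hΘn : mask (largeOff ∅ n) Θ = 0 := by
    rw [hΘ, mask_comm, hn, map_zero]
  have h1 : ‖mask (collision f) (compressedQuery k d Θ)‖ ^ 2
      ≤ (8 * n * k + 32 * k ^ 2) * g * ‖Θ‖ ^ 2 := by
    refine norm_mask_compressedQuery_sq_le fun xs => ?_
    refine (norm_mask_collision_compressedQueryAt_sq_le f (n := n) xs _
      (by rw [mask_sector, hΘc, map_zero]) (by rw [mask_sector, hΘn, map_zero])).trans ?_
    have h2 : (#(univ.image xs) : ℝ) ≤ k := by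
      exact_mod_cast card_image_le.trans (by simp)
    gcongr
  have h3 : ‖mask (collision f) (compressedQuery k d Θ)‖
      ≤ √((8 * n * k + 32 * k ^ 2) * g) * ‖Ψ‖ := by
    refine le_of_sq_le_sq ?_ (by positivity)
    rw [mul_pow, Real.sq_sqrt (by positivity)]
    refine h1.trans ?_
    have := norm_mask_le (collision f)ᶜ Ψ
    gcongr
  calc ‖mask (collision f) (compressedQuery k d Ψ)‖
      = ‖mask (collision f) (compressedQuery k d (mask (collision f) Ψ))
        + mask (collision f) (compressedQuery k d Θ)‖ := by
        rw [← map_add, ← map_add, hΘ, mask_add_mask_compl]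
    _ ≤ _ := norm_add_le_of_le
        ((norm_mask_le _ _).trans_eq (norm_compressedQuery _)) h3

end Transition

section Runs

variable {X Y Z : Type*} [Fintype X] [DecidableEq X] [Fintype Y]

/-! ### The joint state of oracle and algorithm -/

theorem sum_eq_sum_total {g : (X → Option Y) → ℝ} (hg : ∀ D, (∃ x, D x = none) → g D = 0) :
    ∑ D, g D = ∑ H : X → Y, g fun x => some (H x) := by
  symm
  refine sum_of_injOn (fun H x => some (H x)) ?_ (fun _ _ => mem_coe.2 (mem_univ _)) ?_
    fun _ _ => rfl
  · intro H _ H' _ h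
    funext x
    exact Option.some_injective _ (congrFun h x)
  · intro D _ hD
    refine hg D ?_
    by_contra! h
    refine hD ⟨fun x => (D x).get (Option.isSome_iff_ne_none.2 (h x)), by simp, ?_⟩
    funext x
    simp

variable [AddCommGroup Y] {R : Type*} [NormedAddCommGroup R] [InnerProductSpace ℂ R]

/-- The joint state `∑_H |H⟩ ⊗ ψ H / √|X → Y|` of a uniformly random oracle and a system in the
state `ψ H`. It vanishes on the labels `D` with an empty register. -/
noncomputable def joint (ψ : (X → Y) → R) : Reg X Y R :=
  WithLp.toLp 2 fun D => if ∃ x, D x = none then 0 else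
    ((√(Fintype.card (X → Y) : ℝ))⁻¹ : ℂ) • ψ fun x => (D x).getD 0

theorem joint_apply_none (ψ : (X → Y) → R) {D : X → Option Y} (h : ∃ x, D x = none) :
    joint ψ D = 0 := if_pos h

theorem joint_apply_some (ψ : (X → Y) → R) (H : X → Y) :
    joint ψ (fun x => some (H x)) = ((√(Fintype.card (X → Y) : ℝ))⁻¹ : ℂ) • ψ H :=
  if_neg (by simp)

theorem joint_apply_update_none (ψ : (X → Y) → R) (D : X → Option Y) (x : X) :
    joint ψ (Function.update D x none) = 0 :=
  joint_apply_none ψ ⟨x, by simp⟩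

theorem norm_joint_sq (ψ : (X → Y) → R) :
    ‖joint ψ‖ ^ 2 = (∑ H, ‖ψ H‖ ^ 2) / Fintype.card (X → Y) := by
  rw [Reg.norm_sq, sum_eq_sum_total fun D hD => by simp [joint_apply_none ψ hD], sum_div]
  refine sum_congr rfl fun H _ => ?_
  rw [joint_apply_some, norm_smul, mul_pow, norm_inv, Complex.norm_real, Real.norm_eq_abs,
    inv_pow, sq_abs, Real.sq_sqrt (by positivity), div_eq_inv_mul]

/-- The uniform superposition on the register `x` is mapped to `none`. -/
theorem mask_ne_none_compress_joint_const (r : R) (x : X) :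
    mask {D | D x ≠ none} (compress x (joint fun _ : X → Y => r)) = 0 := by
  have hM : (√(Fintype.card Y : ℝ)) ≠ 0 := by
    have : 0 < Fintype.card Y := Fintype.card_pos
    positivity
  ext D
  by_cases hD : D x = none
  · exact mask_apply_notMem _ (by simpa using hD)
  rw [mask_apply_mem _ (by simpa using hD), compress_apply]
  obtain ⟨y, hy⟩ := Option.ne_none_iff_exists'.1 hD
  have hconst : ∀ y', joint (fun _ : X → Y => r) (Function.update D x (some y'))
      = joint (fun _ : X → Y => r) D := by
    intro y'
    by_cases h : ∃ z, D z = none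
    · obtain ⟨z, hz⟩ := h
      have hzx : z ≠ x := fun h => hD (h ▸ hz)
      rw [joint_apply_none _ ⟨z, hz⟩, joint_apply_none _ ⟨z, by simp [hzx, hz]⟩]
    · have h' : ¬ ∃ z, Function.update D x (some y') z = none := by
        rintro ⟨z, hz⟩
        rcases eq_or_ne z x with rfl | hzx
        · simp at hz
        · exact h ⟨z, by simpa [hzx] using hz⟩
      exact (if_neg h').trans (if_neg h).symm
  rw [axisCoeff, Fintype.sum_option, joint_apply_update_none, smul_zero, zero_add, hy]
  simp only [hconst, axis, sum_const, card_univ]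
  rw [← Nat.cast_smul_eq_nsmul ℂ, smul_smul, smul_smul, mul_assoc]
  have h1 : ((-(1 / √(Fintype.card Y : ℝ)) : ℝ) : ℂ) * ((Fintype.card Y : ℂ)
      * ((-(1 / √(Fintype.card Y : ℝ)) : ℝ) : ℂ)) = 1 := by
    have : (-(1 / √(Fintype.card Y : ℝ))) * ((Fintype.card Y : ℝ)
        * (-(1 / √(Fintype.card Y : ℝ)))) = 1 := by
      field_simp
      exact (Real.sq_sqrt (by positivity)).symm
    exact_mod_cast this
  rw [h1, one_smul, sub_self]
  rfl

/-- For a state independent of the oracle, the database is empty. -/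
theorem mask_largeOff_compressOn_joint_const (r : R) :
    mask (largeOff ∅ 0) (compressOn univ (joint fun _ : X → Y => r)) = 0 := by
  ext D
  by_cases hD : D ∈ largeOff ∅ 0
  swap
  · exact mask_apply_notMem _ hD
  obtain ⟨x, hx⟩ := card_pos.1 hD
  have hDx : D ∈ {D : X → Option Y | D x ≠ none} := by
    simpa [Option.isSome_iff_ne_none] using hx
  have hc : Commute (compressOn (univ.erase x) : Module.End ℂ (Reg X Y R))
      (mask {D | D x ≠ none}) :=
    compressOn_commute fun z hz => compress_commute_mask fun D b => by
      simp [Function.update_of_ne (ne_of_mem_erase hz).symm]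
  have hc2 : Commute (compressOn (univ.erase x) : Module.End ℂ (Reg X Y R)) (compress x) :=
    compressOn_commute fun z _ => compress_commute z x
  have h : mask {D | D x ≠ none} (compressOn univ (joint fun _ : X → Y => r)) = 0 := by
    rw [compressOn_univ x, ← hc2.eq, Module.End.mul_apply, ← Module.End.mul_apply, ← hc.eq,
      Module.End.mul_apply, mask_ne_none_compress_joint_const, map_zero]
  rw [mask_apply_mem _ hD, ← mask_apply_mem _ hDx, h]

variable {Ω : Type*} {k q : ℕ}

/-- The joint state after `s` rounds, in the basis of databases. -/
noncomputable def run (A : Algorithm X Y Ω k q) (s : Fin (q + 1)) :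
    Reg X Y (StateSpace X Y k A.d) :=
  compressOn univ (joint fun H => A.state H s)

theorem compressOn_run (A : Algorithm X Y Ω k q) (s : Fin (q + 1)) :
    compressOn univ (run A s) = joint fun H => A.state H s :=
  compressOn_compressOn _ _

theorem run_zero (A : Algorithm X Y Ω k q) :
    run A 0 = compressOn univ (joint fun _ => A.init) := rfl

theorem joint_succ (A : Algorithm X Y Ω k q) (s : Fin q) :
    (joint fun H => A.state H s.succ)
      = diag (fun _ => (A.U s).toLinearEquiv.toLinearMap)
        (oracle k A.d (joint fun H => A.state H s.castSucc)) := by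
  ext D : 1
  by_cases hD : ∃ x, D x = none
  · simp only [oracle, diag_apply]
    rw [joint_apply_none _ hD, joint_apply_none _ hD, map_zero, map_zero]
  · obtain ⟨H, rfl⟩ : ∃ H : X → Y, D = fun x => some (H x) := by
      push Not at hD
      choose H hH using fun x => Option.ne_none_iff_exists'.1 (hD x)
      exact ⟨H, funext hH⟩
    simp only [oracle, diag_apply]
    rw [joint_apply_some, joint_apply_some, map_smul, map_smul]
    simp [Algorithm.state]

theorem run_succ (A : Algorithm X Y Ω k q) (s : Fin q) :
    run A s.succ = diag (fun _ => (A.U s).toLinearEquiv.toLinearMap)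
      (compressedQuery k A.d (run A s.castSucc)) := by
  have hc : Commute (compressOn univ) (diag fun _ : X → Option Y =>
      (A.U s).toLinearEquiv.toLinearMap) :=
    compressOn_commute fun _ _ => compress_commute_diag fun _ _ => rfl
  rw [run, joint_succ, ← Module.End.mul_apply, hc.eq, Module.End.mul_apply, compressedQuery,
    Module.End.mul_apply, Module.End.mul_apply, compressOn_run]

omit [AddCommGroup Y] in
theorem norm_diag_unitary {d : ℕ} (U : StateSpace X Y k d ≃ₗᵢ[ℂ] StateSpace X Y k d)
    (Ψ : Reg X Y (StateSpace X Y k d)) :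
    ‖diag (fun _ => U.toLinearEquiv.toLinearMap) Ψ‖ = ‖Ψ‖ :=
  norm_diag (fun _ ψ => U.norm_map ψ) Ψ

theorem norm_run (A : Algorithm X Y Ω k q) (s : Fin (q + 1)) : ‖run A s‖ = 1 := by
  induction s using Fin.induction with
  | zero =>
    have h : ‖run A 0‖ ^ 2 = 1 := by
      rw [run_zero, norm_compressOn, norm_joint_sq]
      simp [A.norm_init]
    nlinarith [norm_nonneg (run A 0)]
  | succ s ih => rw [run_succ, norm_diag_unitary, norm_compressedQuery, ih]

theorem mask_largeOff_run (A : Algorithm X Y Ω k q) (s : Fin (q + 1)) :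
    mask (largeOff ∅ (s * k)) (run A s) = 0 := by
  induction s using Fin.induction with
  | zero => simpa [run_zero] using mask_largeOff_compressOn_joint_const A.init
  | succ s ih =>
    rw [Fin.val_castSucc] at ih
    rw [run_succ, mask_diag, Fin.val_succ, add_mul, one_mul, mask_largeOff_compressedQuery ih,
      map_zero]

theorem norm_mask_collision_run_le (f : X × Y → Z) (A : Algorithm X Y Ω k q) (s : Fin (q + 1)) :
    ‖mask (collision f) (run A s)‖
      ≤ s * √(32 * k ^ 2 * q * (Gam f / Fintype.card Y)) := by
  induction s using Fin.induction with
  | zero =>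
    have h : mask (collision f) (run A 0) = 0 := by
      refine mask_eq_zero_mono (fun D hD => ?_) (mask_largeOff_run A 0)
      obtain ⟨x, _, _, y, _, hy, _⟩ := hD
      rw [Fin.val_zero, zero_mul]
      exact card_pos.2 ⟨x, by simp [hy]⟩
    rw [h]
    simp
  | succ s ih =>
    rw [run_succ, mask_diag, norm_diag_unitary]
    refine (norm_mask_collision_compressedQuery_le f (mask_largeOff_run A s.castSucc)).trans ?_
    rw [norm_run, mul_one, Fin.val_succ, Nat.cast_add, Nat.cast_one, add_one_mul]
    refine add_le_add ih (Real.sqrt_le_sqrt ?_)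
    have h : ((s : ℕ) : ℝ) + 1 ≤ q := by exact_mod_cast s.2
    refine mul_le_mul_of_nonneg_right ?_ (by positivity)
    simp only [Fin.val_castSucc, Nat.cast_mul]
    nlinarith [mul_le_mul_of_nonneg_left h (sq_nonneg (k : ℝ)),
      mul_nonneg (Nat.cast_nonneg (α := ℝ) (s : ℕ)) (sq_nonneg (k : ℝ))]

/-! ### The output -/

/-- The projection onto the pairs of an oracle and an output `(x, x')` that is a collision for it.
-/
noncomputable def accept {d : ℕ} (f : X × Y → Z) (out : Label X Y k d → X × X) :
    Module.End ℂ (Reg X Y (StateSpace X Y k d)) :=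
  diag fun D => restr {b | (out b).1 ≠ (out b).2 ∧ D ∈ pairCollision f (out b).1 (out b).2}

omit [AddCommGroup Y] in
theorem norm_accept_le {d : ℕ} (f : X × Y → Z) (out : Label X Y k d → X × X)
    (Ψ : Reg X Y (StateSpace X Y k d)) : ‖accept f out Ψ‖ ≤ ‖Ψ‖ := by
  refine le_of_sq_le_sq ?_ (norm_nonneg _)
  rw [Reg.norm_sq, Reg.norm_sq]
  refine sum_le_sum fun D _ => ?_
  have := norm_restr_le {b | (out b).1 ≠ (out b).2 ∧ D ∈ pairCollision f (out b).1 (out b).2} (Ψ D)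
  simp only [accept, diag_apply]
  gcongr

omit [AddCommGroup Y] in
theorem sector_accept {d : ℕ} (f : X × Y → Z) (out : Label X Y k d → X × X) (p : X × X)
    (Ψ : Reg X Y (StateSpace X Y k d)) : sector out p (accept f out Ψ)
      = if p.1 ≠ p.2 then mask (pairCollision f p.1 p.2) (sector out p Ψ) else 0 := by
  ext D b
  by_cases hb : out b = p
  · subst hb
    by_cases hne : (out b).1 = (out b).2
    · simp [sector, accept, restr_apply, hne]
    · by_cases hD : D ∈ pairCollision f (out b).1 (out b).2 <;>
        simp [sector, accept, restr_apply, hne, mask_apply, hD]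
  · split_ifs
    · by_cases hD : D ∈ pairCollision f p.1 p.2 <;>
        simp [sector, accept, restr_apply, hb, mask_apply, hD]
    · simp [sector, accept, restr_apply, hb]

/-- The output is a collision of the oracle with small amplitude unless the database has a
collision. For an output `(x, x')`, only the reflections on the registers `x` and `x'` leak. -/
theorem norm_accept_compressOn_le {d : ℕ} (f : X × Y → Z) (out : Label X Y k d → X × X)
    (Ψ : Reg X Y (StateSpace X Y k d)) :
    ‖accept f out (compressOn univ Ψ)‖
      ≤ ‖mask (collision f) Ψ‖ + √(8 * (Gam f / Fintype.card Y)) * ‖Ψ‖ := by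
  set g : ℝ := Gam f / Fintype.card Y
  have hg0 : 0 ≤ g := by positivity
  set Θ := mask (collision f)ᶜ Ψ with hΘ
  have hΘc : mask (collision f) Θ = 0 := mask_mask_compl _ _
  have h1 : ‖accept f out (compressOn univ Θ)‖ ^ 2 ≤ 8 * g * ‖Θ‖ ^ 2 := by
    rw [← sum_norm_sector_sq out (accept f out _), ← sum_norm_sector_sq out Θ, mul_sum]
    refine sum_le_sum fun p _ => ?_
    rw [sector_accept]
    split_ifs with hp
    swap
    · rw [norm_zero, zero_pow two_ne_zero]
      exact mul_nonneg (by positivity) (sq_nonneg _)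
    rw [show sector out p (compressOn univ Θ) = compressOn univ (sector out p Θ) from
      (LinearMap.congr_fun (compressOn_commute_sector out p univ).eq Θ).symm]
    have hl := leak_compressOn (S := pairCollision f p.1 p.2)
      (c := fun z => if z = p.1 ∨ z = p.2 then √(2 * g) else 0) (fun z => by positivity)
      (fun z => leak_compress_pairCollision (R := StateSpace X Y k d) f hp z) univ
    refine (hl.norm_sq_le ?_).trans (le_of_eq ?_)
    · rw [mask_sector, mask_eq_zero_mono (pairCollision_subset_collision f hp) hΘc, map_zero]
    · have hQ : ({z | z = p.1 ∨ z = p.2} : Finset X) = {p.1, p.2} := by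
        ext z
        simp
      rw [← sum_filter, hQ, sum_const, card_pair hp, nsmul_eq_mul, mul_pow,
        Real.sq_sqrt (by positivity)]
      push_cast
      ring
  have h3 : ‖accept f out (compressOn univ Θ)‖ ≤ √(8 * g) * ‖Ψ‖ := by
    refine le_of_sq_le_sq ?_ (by positivity)
    rw [mul_pow, Real.sq_sqrt (by positivity)]
    refine h1.trans ?_
    have := norm_mask_le (collision f)ᶜ Ψ
    gcongr
  calc ‖accept f out (compressOn univ Ψ)‖
      = ‖accept f out (compressOn univ (mask (collision f) Ψ))
        + accept f out (compressOn univ Θ)‖ := by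
        rw [← map_add, ← map_add, hΘ, mask_add_mask_compl]
    _ ≤ _ := norm_add_le_of_le ((norm_accept_le _ _ _).trans_eq (norm_compressOn _ _)) h3

end Runs

section Success

variable {X Y Z : Type*} [Fintype X] [Fintype Y] [AddCommGroup Y] {k q : ℕ}

open Classical in
/-- The success probability, read off from the joint state in the basis of oracles. -/
theorem successProb_eq (f : X × Y → Z) (A : Algorithm X Y (X × X) k q) :
    A.successProb (IsGenCollision f)
      = ‖accept f A.out (joint fun H => A.state H (Fin.last q))‖ ^ 2 := by
  rw [Reg.norm_sq, sum_eq_sum_total, Algorithm.successProb, sum_div]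
  · refine sum_congr rfl fun H _ => ?_
    rw [Algorithm.outputProb, EuclideanSpace.norm_sq_eq, sum_div]
    refine sum_congr rfl fun b _ => ?_
    simp only [accept, diag_apply, restr_apply, joint_apply_some, Set.mem_ofPred_eq]
    have h : (IsGenCollision f H (A.out b)) ↔ ((A.out b).1 ≠ (A.out b).2 ∧
        (fun x => some (H x)) ∈ pairCollision f (A.out b).1 (A.out b).2) := by
      simp [IsGenCollision, pairCollision]
    by_cases hw : IsGenCollision f H (A.out b)
    · rw [if_pos hw, if_pos (h.1 hw), PiLp.smul_apply, norm_smul, mul_pow, norm_inv,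
        Complex.norm_real, Real.norm_eq_abs, inv_pow, sq_abs, Real.sq_sqrt (by positivity),
        div_eq_inv_mul]
    · rw [if_neg hw, if_neg fun h' => hw (h.2 h')]
      simp
  · intro D hD
    simp only [accept, diag_apply]
    rw [joint_apply_none _ hD]
    simp

theorem successProb_le (f : X × Y → Z) (A : Algorithm X Y (X × X) k q) :
    A.successProb (IsGenCollision f)
      ≤ (q * √(32 * k ^ 2 * q * (Gam f / Fintype.card Y))
          + √(8 * (Gam f / Fintype.card Y))) ^ 2 := by
  classical
  rw [successProb_eq, ← compressOn_run]
  refine pow_le_pow_left₀ (norm_nonneg _) ?_ 2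
  refine (norm_accept_compressOn_le f A.out _).trans ?_
  rw [norm_run, mul_one]
  gcongr
  simpa using norm_mask_collision_run_le f A (Fin.last q)

/-! ### Numerical comparison -/

theorem sqrt_add_sqrt_le {k q : ℕ} (hk : 1 ≤ k) {g : ℝ} (hg : 0 ≤ g) :
    q * √(32 * k ^ 2 * q * g) + √(8 * g)
      ≤ 2 * ((q : ℝ) + 1) * Real.exp 1 * k * √(10 * (g * (q + 1))) := by
  have hk1 : (1 : ℝ) ≤ k := by exact_mod_cast hk
  have he : (2 : ℝ) ≤ Real.exp 1 := by linarith [Real.add_one_le_exp 1]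
  have hq : (0 : ℝ) ≤ q := Nat.cast_nonneg q
  set r := √(10 * (g * (q + 1))) with hr
  have h1 : √(32 * k ^ 2 * q * g) ≤ 2 * k * r := by
    refine Real.sqrt_le_iff.2 ⟨by positivity, ?_⟩
    rw [mul_pow, hr, Real.sq_sqrt (by positivity)]
    have : 0 ≤ (k : ℝ) ^ 2 * g := by positivity
    nlinarith [mul_nonneg this hq]
  have h2 : √(8 * g) ≤ r := Real.sqrt_le_sqrt (by nlinarith [mul_nonneg hg hq])
  have hr0 : 0 ≤ r := Real.sqrt_nonneg _
  calc q * √(32 * k ^ 2 * q * g) + √(8 * g) ≤ q * (2 * k * r) + k * r := by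
        gcongr
        nlinarith
    _ ≤ 2 * ((q : ℝ) + 1) * 2 * k * r := by
        have : 0 ≤ k * r := by positivity
        nlinarith [mul_nonneg hq this]
    _ ≤ _ := by gcongr

theorem successProb_le_collisionBound (f : X × Y → Z) (hk : 1 ≤ k)
    (A : Algorithm X Y (X × X) k q) : A.successProb (IsGenCollision f)
      ≤ collisionBound k q (Gam f) (Fintype.card Y) := by
  refine (successProb_le f A).trans ?_
  unfold collisionBound
  have h := sqrt_add_sqrt_le (q := q) hk (g := Gam f / Fintype.card Y) (by positivity)
  refine pow_le_pow_left₀ (by positivity) (h.trans ?_) 2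
  rw [show 10 * ((Gam f : ℝ) / Fintype.card Y * (q + 1))
    = 10 * Gam f * ((q + 1) / Fintype.card Y) by ring]
  exact le_add_of_nonneg_right (by positivity)

theorem leading_term_sq_le {k q Γ : ℕ} (hk : 1 ≤ k) (hq : 1 ≤ q) {M : ℝ} (hM : 0 ≤ M) :
    (2 * ((q : ℝ) + 1) * Real.exp 1 * k * √(10 * Γ * ((q + 1) / M))) ^ 2
      ≤ 2880 * (k ^ 2 * q ^ 3 * Γ / M) := by
  have hq1 : (1 : ℝ) ≤ q := by exact_mod_cast hq
  have he : Real.exp 1 ≤ 3 := by linarith [Real.exp_one_lt_d9]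
  rw [mul_pow, Real.sq_sqrt (by positivity)]
  calc (2 * ((q : ℝ) + 1) * Real.exp 1 * k) ^ 2 * (10 * Γ * ((q + 1) / M))
      ≤ (2 * ((q : ℝ) + q) * 3 * k) ^ 2 * (10 * Γ * ((q + q) / M)) := by gcongr
    _ = 2880 * (k ^ 2 * q ^ 3 * Γ / M) := by ring

theorem successProb_le_asymptotic (f : X × Y → Z) (hk : 1 ≤ k) (hq : 1 ≤ q)
    (A : Algorithm X Y (X × X) k q) : A.successProb (IsGenCollision f)
      ≤ 2880 * (k ^ 2 * q ^ 3 * Gam f / Fintype.card Y) := by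
  refine (successProb_le f A).trans (le_trans ?_ (leading_term_sq_le hk hq (by positivity)))
  refine pow_le_pow_left₀ (by positivity) ?_ 2
  rw [show 10 * (Gam f : ℝ) * ((q + 1) / Fintype.card Y)
    = 10 * ((Gam f : ℝ) / Fintype.card Y * (q + 1)) by ring]
  exact sqrt_add_sqrt_le hk (by positivity)

theorem collisionBound_le {k q Γ M : ℕ} (hk : 1 ≤ k) (hq : 1 ≤ q) (hΓ : 1 ≤ Γ) :
    collisionBound k q Γ M ≤ 5768 * (k ^ 2 * q ^ 3 * Γ / M) := by
  unfold collisionBound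
  have h1 := leading_term_sq_le (Γ := Γ) hk hq (M := M) (by positivity)
  -- The term `4 / M` is absorbed because `1 ≤ k ^ 2 * q ^ 3 * Γ`.
  have h2 : (2 / √(M : ℝ)) ^ 2 ≤ 4 * (k ^ 2 * q ^ 3 * Γ / M) := by
    rw [div_pow, Real.sq_sqrt (by positivity), ← mul_div_assoc]
    have h3 : (1 : ℝ) ≤ k ^ 2 * q ^ 3 * Γ := by
      exact_mod_cast Nat.mul_pos (Nat.mul_pos (pow_pos hk 2) (pow_pos hq 3)) hΓ
    gcongr
    linarith
  refine (add_sq_le (a := 2 * ((q : ℝ) + 1) * Real.exp 1 * k * √(10 * Γ * ((q + 1) / M)))).trans ?_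
  linarith

end Success
end ParallelQROM

theorem mainTheorem8 :
    ∃ C : ℝ, 0 < C ∧
      ∀ (X Y Z : Type*) [Fintype X] [Nonempty X] [Fintype Y] [AddCommGroup Y]
        (f : X × Y → Z) (k q : ℕ), 1 ≤ k →
        (∀ A : ParallelQROM.Algorithm X Y (X × X) k q,
          A.successProb (ParallelQROM.IsGenCollision f) ≤
              ParallelQROM.collisionBound k q (ParallelQROM.Gam f) (Fintype.card Y) ∧
          (1 ≤ q →
            A.successProb (ParallelQROM.IsGenCollision f) ≤
              C * ((k : ℝ) ^ 2 * (q : ℝ) ^ 3 * (ParallelQROM.Gam f : ℝ) /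
                (Fintype.card Y : ℝ)))) ∧
        (1 ≤ q → 1 ≤ ParallelQROM.Gam f →
          ParallelQROM.collisionBound k q (ParallelQROM.Gam f) (Fintype.card Y) ≤
            C * ((k : ℝ) ^ 2 * (q : ℝ) ^ 3 * (ParallelQROM.Gam f : ℝ) /
              (Fintype.card Y : ℝ))) := by
  -- `(a + b) ^ 2 ≤ 2 * (a ^ 2 + b ^ 2)` gives the constant `5768 = 2 * (2880 + 4)`.
  refine ⟨5768, by norm_num, ?_⟩
  intro X Y Z _ _ _ _ f k q hk
  refine ⟨fun A => ⟨ParallelQROM.successProb_le_collisionBound f hk A, fun hq => ?_⟩,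
    fun hq hΓ => ParallelQROM.collisionBound_le hk hq hΓ⟩
  refine (ParallelQROM.successProb_le_asymptotic f hk hq A).trans ?_
  exact mul_le_mul_of_nonneg_right (by norm_num) (by positivity)
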